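/- **Theorem.** Write $x^{[p]}=|x|^p\,\mathrm{sgn}(x)$ (componentwise for vectors). Consider $n\ge 2$ agents $$\dot x_{i1}=x_{i2},\qquad \dot x_{i2}=u_i+f_i(\bar x_i)+d_i(\bar x_i,t),\qquad x_{i1},x_{i2}\in\mathbb R^3,\ \bar x_i=(x_{i1},x_{i2}),$$ with $f_i$ locally Lipschitz, $f_i(0)=0$, moving obstacles with differentiable trajectories, and a leader with twice differentiable trajectory $x_o$. *Sliding parameters.* Let $\beta_1,\beta_2,c_0,c_1,c_2,\phi_s,\varrho,r_1,r_2>0$, $r_0\in(\frac12,1)$, $r_1r_0>1$, $r_2r_0<1$, and let $B(x)=(\beta_1x^{[r_1]}+\beta_2x^{[r_2]})^{[r_0]}$, $\wp_1=(2-r_0)(\beta_1\phi_s^{(r_1r_0-1)/r_0}+\beta_2\phi_s^{(r_2r_0-1)/r_0})^{r_0}$, $\wp_2=(r_0-1)(\beta_1\phi_s^{(r_1r_0-2)/r_0}+\beta_2\phi_s^{(r_2r_0-2)/r_0})^{r_0}$, $Q(x)=\wp_1x+\wp_2x^{[2]}$. Let $\alpha(\sigma,x)=Q(x)$ if $\sigma\ne0$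 and $|x|\le\phi_s$, and $\alpha(\sigma,x)=B(x)$ otherwise. *Estimator.* Let $(a_{ij})$ be the nonnegative symmetric adjacency matrix (zero diagonal) of the communication graph and $b_i\ge 0$ leader weights, not all zero. With $e_i=\sum_{j}a_{ij}(\hat x_{i1}-\hat x_{j1})+b_i(\hat x_{i1}-x_o)$, $$\dot{\hat x}_{i1}=-K_1e_i^{[r_3/r_4]}-K_2e_i^{[r_5/r_6]}-K_3\,\mathrm{sgn}(e_i),\qquad K_1,K_2,K_3>0,\ r_3/r_4>1,\ 0<r_5/r_6<1 .$$ *Desired velocity.* Let $x_i^o$ be the position of the obstacle or other agent closest to agent $i$, with velocity $\dot x_i^o$; $p_i=x_{i1}-x_i^o$, $q_i=x_{i1}-\hat x_{i1}$, $p^\dagger=p/\|p\|^2$; $\tilde\rho_{io}=\frac12(d^2-\|p_i\|^2)$, $\tilde\rho_{if}=\frac12(d_{i0}^2-\|q_i\|^2)$, where $d,d_{i0}>0$ and $2\phi_s<d^2,d_{i0}^2$; $\alpha_{i\bullet}=\alpha(\dot{\tilde\rho}_{i\bullet}+c_0B(\tilde\rho_{i\bullet}),\tilde\rho_{i\bullet})$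 for $\bullet=o,f$. Put $v_{io}=p_i^\dagger(\lambda_{io}\alpha_{io}+p_i^\top\dot x_i^o)$, $v_{if}=q_i^\dagger(\lambda_f\alpha_{if}+q_i^\top\dot{\hat x}_{i1})$ with $\lambda_f>0$. The desired velocity is $\dot x_{id}=v_{io}+(I-p_i^\dagger p_i^\top)v_{if}$, with the additional term $\int_t^{t+1}\delta_d\,\mathcal R_z(\theta_z)\mathcal R_y(\theta_y)\mathcal R_x(\theta_x)\,p_i/\|p_i\|$ (where $\delta_d>0$, the $\mathcal R$ are rotations about the axes, and the angles in $[-\frac\pi2,\frac\pi2]$ are not all $0$) when $v_{io}+v_{if}=0$; outside the repulsive zone, that is for $\|p_i\|>d$, the avoidance task may also be inactive, in which case $\dot x_{id}=v_{if}$. The reference position $x_{id}$ is a primitive of $\dot x_{id}$, and $\dot x_{id}$ is assumed locally absolutely continuous on $[0,\infty)$ apart from at most finitely many switching times. *Controller.* Let $\tilde x_{i1}=x_{i1}-x_{id}$, $\tilde x_{i2}=x_{i2}-\dot x_{id}$, and componentwise $\sigma_{1i}=\tilde x_{i2}+c_1\tilde x_{i1}+c_2B(\tilde x_{i1})$, $\sigma_{2i}=\tilde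 x_{i2}+c_1\tilde x_{i1}+c_2Q(\tilde x_{i1})$; $S_{ij}=\varrho\,\sigma_{2i_j}$ if $\sigma_{1i_j}\ne0$ and $|\tilde x_{i1_j}|\le\phi_s$, and $S_{ij}=\varrho\,\sigma_{1i_j}$ otherwise. Let $\alpha_i=\alpha(\sigma_{1i},\tilde x_{i1})$ componentwise, $z_i=(x_{i1},x_{i2},\ddot x_{id},\dot{\tilde x}_{i1},\dot\alpha_i)\in\mathbb R^{15}$, and $F_i(z_i)=f_i(\bar x_i)-\ddot x_{id}+c_1\dot{\tilde x}_{i1}+c_2\dot\alpha_i$. Let $\phi_i(z)=(\exp(-\|z-\mu_{ik}\|^2/\psi_{ik}^2))_{k\le h_i}$ with $\psi_{ik}>0$. The control is $$u_i=-k_{1i}(t)S_i^{[\gamma_1]}-k_{2i}(t)S_i^{[\gamma_2]}-\hat W_i^\top\phi_i(z_i)-\hat\delta_i\,\mathrm{sgn}(S_i),\qquad \dot{\hat W}_i=\Gamma_i\phi_i(z_i)S_i^\top,\qquad \dot{\hat\delta}_i=\gamma_{3i}\|S_i\|_1,$$ $$k_{li}(t)=k_{li}^0+\frac{k_{li}^M-k_{li}^0}{\exp(-c_{sl}(t-T_0))+1}\quad(l=1,2),$$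 with $\gamma_1>1$, $0<\gamma_2<1$, $k_{li}^M>k_{li}^0>0$, $c_{sl},T_0,\gamma_{3i}>0$, $\Gamma_i$ positive definite. Solutions are understood in Filippov's sense on $[0,\infty)$. *Assumptions.* (a) There are compact sets $\Omega_{zi}\subset\mathbb R^{15}$, weights $W_i^*(t)$ and $\varepsilon_{Ni}>0$ such that $\varepsilon_i=F_i(z)-W_i^*(t)^\top\phi_i(z)$ satisfies $\|\varepsilon_i\|\le\varepsilon_{Ni}$ for all $t\ge0$, $z\in\Omega_{zi}$; and along the solution, for almost all times from some time on, $z_i\in\Omega_{zi}$ and $\|\varepsilon_i+d_i\|\le\delta_i$ with constants $\delta_i$. (b) $K_3\ge\sup_{t\ge0}\|\dot x_o(t)\|_\infty$. (c) For all $t\ge0$, $\lambda_{io}>\max\{\lambda_{io1},\lambda_{io2},\lambda_i^*\}$ and $\lambda_{io}>0$. Here $$\lambda_i^*=\frac{-\Upsilon_{2i}+\sqrt{\Upsilon_{2i}^2-4\Upsilon_{1i}\Upsilon_{3i}}}{2\Upsilon_{1i}},\quad \Upsilon_{1i}=\|p_i^\dagger\|^2\alpha_{io}^2,\quad \Upsilon_{2i}=-2\|p_i^\dagger\||\alpha_{io}|\,m_i,\quad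 \Upsilon_{3i}=-m_i^2,\quad m_i=\|x_{i2}\|+c_1\|\tilde x_{i1}\|+c_2\|\alpha_i\|$$ (no condition from $\lambda_i^*$ where $\Upsilon_{1i}=0$), and with $\phi_s^*=B(\phi_s)$, $L_0^*=B(L_0)$, $$\lambda_{io1}=\frac{\gamma_{io}\lambda_fL_{iof}}{\gamma_{i\varepsilon}}+\frac{\gamma_{io}L_{io}L_{i\hat x}}{\phi_s^*\gamma_{i\varepsilon}}+\frac{\gamma_fL_{if}(L_{i\hat x}+L_i^o)}{\phi_s^*\gamma_{i\varepsilon}}+\frac{\gamma_{io}\lambda_{iv}}{\gamma_{i\varepsilon}},$$ $$\lambda_{io2}=\frac{\gamma_{io}\lambda_fL_{iof}L_0^*}{\gamma_{i\varepsilon}\phi_s^*}+\frac{\gamma_{io}L_{io}L_{i\hat x}}{\phi_s^*\gamma_{i\varepsilon}}+\frac{\gamma_fL_{if}(L_{i\hat x}+L_i^o)L_0}{\phi_s^*\phi_s\gamma_{i\varepsilon}}+\frac{\gamma_{io}\lambda_{iv}}{\gamma_{i\varepsilon}},$$ where $\gamma_{i\varepsilon},\lambda_{iv},\gamma_f>0$,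 $L_0>\phi_s$, $L_0\ge|\tilde\rho_{io}(0)|,|\tilde\rho_{if}(0)|$ for all $i$, $\gamma_{io}\ge d_{i0}\gamma_fL_0/(d\phi_s)+\gamma_{i\varepsilon}$, $L_i^o=\sup_{t\ge0}\|\dot x_i^o\|<\infty$, $L_{iof}=\sqrt{(d^2+2L_0)/(d_{i0}^2-2\phi_s)}$, $L_{io}=\sqrt{d^2+2L_0}$, $L_{if}=\sqrt{d_{i0}^2+2L_0}$, $L_{i\hat x}=K_1\|\eta_i(r_3/r_4)\|+K_2\|\eta_i(r_5/r_6)\|+\sqrt3K_3$, and, with $\bar x_{i1}=\hat x_{i1}-x_o$, $\eta_i(p)=\sum_ja_{ij}(\bar x_{i1}(0)^{[p]}+\bar x_{j1}(0)^{[p]})+b_i\bar x_{i1}(0)^{[p]}$. *Conclusion.* For every solution of the closed loop and every $\delta_s>0$ there is a finite $T_{S1}>0$ such that $\|S_i(t)\|\le\delta_s$ for all $i$ and all $t\ge T_{S1}$. -/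

import Mathlib

open MeasureTheory Set

noncomputable section

namespace MultiAgent

/-- Three-dimensional Euclidean space. -/
abbrev E3 : Type := EuclideanSpace ℝ (Fin 3)

/-- The space `ℝ¹⁵` of the network inputs: five stacked vectors of `ℝ³`, with the Euclidean norm. -/
abbrev Z15 : Type := EuclideanSpace ℝ (Fin 5 × Fin 3)

/-- The signed power `x^[p] = |x|^p sgn x`. -/
def spow (x p : ℝ) : ℝ := |x| ^ p * Real.sign x

/-- The values of the sign function at `s` in Filippov's sense:
`{1}` for `s > 0`, `{-1}` for `s < 0`, and `[-1, 1]` for `s = 0`. -/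
def SGN (s : ℝ) : Set ℝ := {ξ | (0 < s → ξ = 1) ∧ (s < 0 → ξ = -1) ∧ |ξ| ≤ 1}

/-- Local absolute continuity on `[0, ∞)`. -/
def LocAC {X : Type*} [PseudoMetricSpace X] (g : ℝ → X) : Prop :=
  ∀ b : ℝ, 0 ≤ b → AbsolutelyContinuousOnInterval g 0 b

/-- Piecewise local absolute continuity on `[0, ∞)`: there are at most finitely many exceptional
(switching) times, and `g` is absolutely continuous on every compact interval that avoids them. -/
def PiecewiseLocAC {X : Type*} [PseudoMetricSpace X] (g : ℝ → X) : Prop :=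
  ∃ J : Finset ℝ, ∀ a b : ℝ, 0 ≤ a → a ≤ b → (∀ s ∈ J, s ∉ Icc a b) →
    AbsolutelyContinuousOnInterval g a b

/-- A property holds for almost every time `t ≥ 0`. -/
def AETime (p : ℝ → Prop) : Prop := ∀ᵐ t ∂(volume.restrict (Ici (0 : ℝ))), p t

/-- A property holds for almost every time from some time on. -/
def AEEventually (p : ℝ → Prop) : Prop := ∃ t₀ : ℝ, ∀ᵐ t ∂(volume.restrict (Ici t₀)), p t

/-! ### The terminal sliding mode functions -/

/-- Parameters of the fixed-time terminal sliding mode. -/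
structure SlidingParams where
  β₁ : ℝ
  β₂ : ℝ
  c₀ : ℝ
  c₁ : ℝ
  c₂ : ℝ
  φs : ℝ
  r₀ : ℝ
  r₁ : ℝ
  r₂ : ℝ
  ϱ : ℝ
  β₁_pos : 0 < β₁
  β₂_pos : 0 < β₂
  c₀_pos : 0 < c₀
  c₁_pos : 0 < c₁
  c₂_pos : 0 < c₂
  φs_pos : 0 < φs
  r₀_gt : 1 / 2 < r₀
  r₀_lt : r₀ < 1
  r₁_pos : 0 < r₁
  r₂_pos : 0 < r₂
  r₁r₀ : 1 < r₁ * r₀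
  r₂r₀ : r₂ * r₀ < 1
  ϱ_pos : 0 < ϱ

namespace SlidingParams

variable (P : SlidingParams)

/-- `(β₁ x^[r₁] + β₂ x^[r₂])^[r₀]`. -/
def terminal (x : ℝ) : ℝ := spow (P.β₁ * spow x P.r₁ + P.β₂ * spow x P.r₂) P.r₀

/-- The coefficient `℘₁`. -/
def wp₁ : ℝ :=
  (2 - P.r₀) * spow (P.β₁ * spow P.φs ((P.r₁ * P.r₀ - 1) / P.r₀)
    + P.β₂ * spow P.φs ((P.r₂ * P.r₀ - 1) / P.r₀)) P.r₀

/-- The coefficient `℘₂`. -/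
def wp₂ : ℝ :=
  (P.r₀ - 1) * spow (P.β₁ * spow P.φs ((P.r₁ * P.r₀ - 2) / P.r₀)
    + P.β₂ * spow P.φs ((P.r₂ * P.r₀ - 2) / P.r₀)) P.r₀

/-- `℘₁ x + ℘₂ x^[2]`. -/
def poly (x : ℝ) : ℝ := P.wp₁ * x + P.wp₂ * spow x 2

open Classical in
/-- The switched function `α`, with the switching value `σ` as an argument. -/
def alpha (σ x : ℝ) : ℝ := if σ ≠ 0 ∧ |x| ≤ P.φs then P.poly x else P.terminal x

open Classical in
/-- The continuous function of `x` with which `α` agrees off the surface `σ = 0`. -/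
def alphaReg (x : ℝ) : ℝ := if |x| ≤ P.φs then P.poly x else P.terminal x

/-- Switching function of a task error `x` with time derivative `x'`. -/
def taskSigma (x' x : ℝ) : ℝ := x' + P.c₀ * P.terminal x

/-- `σ₁`, for one coordinate `(x, y)` of the position and velocity tracking errors. -/
def σ₁ (x y : ℝ) : ℝ := y + P.c₁ * x + P.c₂ * P.terminal x

/-- `σ₂`, for one coordinate `(x, y)` of the position and velocity tracking errors. -/
def σ₂ (x y : ℝ) : ℝ := y + P.c₁ * x + P.c₂ * P.poly x

open Classical in
/-- The terminal sliding mode `S` as a function of the position and velocity tracking errors. -/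
def slide (e₁ e₂ : E3) : E3 :=
  WithLp.toLp 2 fun j =>
    if P.σ₁ (e₁ j) (e₂ j) ≠ 0 ∧ |e₁ j| ≤ P.φs then P.ϱ * P.σ₂ (e₁ j) (e₂ j)
    else P.ϱ * P.σ₁ (e₁ j) (e₂ j)

/-- The value of the sliding mode in Filippov's sense. The function `slide` agrees with this
continuous function off the Lebesgue null set where some coordinate of `σ₁` vanishes, so this is
the only element of its Filippov regularization. -/
def slideReg (e₁ e₂ : E3) : E3 :=
  WithLp.toLp 2 fun j => P.ϱ * (e₂ j + P.c₁ * e₁ j + P.c₂ * P.alphaReg (e₁ j))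

end SlidingParams

/-! ### Agents, environment, design parameters -/

/-- The unknown dynamics `f i` and the external disturbances `dist i` of the `n` agents;
their arguments are the pair (position, velocity) and, for `dist`, the time. -/
structure Agents (n : ℕ) where
  f : Fin n → E3 × E3 → E3
  f_lip : ∀ i, LocallyLipschitz (f i)
  f_zero : ∀ i, f i 0 = 0
  dist : Fin n → E3 × E3 → ℝ → E3

/-- `m` moving environmental obstacles, and the virtual leader. -/
structure Environment (m : ℕ) where
  obs : Fin m → ℝ → E3
  obs_diff : ∀ k, Differentiable ℝ (obs k)
  leader : ℝ → E3
  leader_diff : Differentiable ℝ leader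
  leader_diff₂ : Differentiable ℝ (deriv leader)

/-- The communication network and all parameters of the estimator, of the desired velocities and
of the controller. The `i`-th network has `h i` neurons. -/
structure Design (n : ℕ) (h : Fin n → ℕ) extends SlidingParams where
  /-- weighted adjacency matrix of the undirected graph -/
  a : Matrix (Fin n) (Fin n) ℝ
  a_nonneg : ∀ i j, 0 ≤ a i j
  a_symm : a.IsSymm
  a_diag : ∀ i, a i i = 0
  /-- leader adjacency weights -/
  b : Fin n → ℝ
  b_nonneg : ∀ i, 0 ≤ b i
  b_pos : ∃ i, 0 < b i
  /-- estimator gains; `p₁ = r₃ / r₄` and `p₂ = r₅ / r₆` -/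
  K₁ : ℝ
  K₂ : ℝ
  K₃ : ℝ
  p₁ : ℝ
  p₂ : ℝ
  K₁_pos : 0 < K₁
  K₂_pos : 0 < K₂
  K₃_pos : 0 < K₃
  p₁_gt : 1 < p₁
  p₂_pos : 0 < p₂
  p₂_lt : p₂ < 1
  /-- radius of the repulsive zones -/
  d : ℝ
  d_pos : 0 < d
  d_φs : 2 * φs < d ^ 2
  /-- desired distances to the leader -/
  d₀ : Fin n → ℝ
  d₀_pos : ∀ i, 0 < d₀ i
  d₀_φs : ∀ i, 2 * φs < d₀ i ^ 2
  /-- gain of the cooperative behavior -/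
  lamf : ℝ
  lamf_pos : 0 < lamf
  /-- the term that is added at local minima -/
  δd : ℝ
  δd_pos : 0 < δd
  θ : Fin n → ℝ → Fin 3 → ℝ
  θ_mem : ∀ i t k, θ i t k ∈ Icc (-(Real.pi / 2)) (Real.pi / 2)
  θ_ne : ∀ i t, θ i t 0 ^ 2 + θ i t 1 ^ 2 + θ i t 2 ^ 2 ≠ 0
  /-- reaching law -/
  γ₁ : ℝ
  γ₂ : ℝ
  γ₁_gt : 1 < γ₁
  γ₂_pos : 0 < γ₂
  γ₂_lt : γ₂ < 1
  k₁0 : Fin n → ℝ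
  k₁M : Fin n → ℝ
  k₂0 : Fin n → ℝ
  k₂M : Fin n → ℝ
  k₁0_pos : ∀ i, 0 < k₁0 i
  k₁M_gt : ∀ i, k₁0 i < k₁M i
  k₂0_pos : ∀ i, 0 < k₂0 i
  k₂M_gt : ∀ i, k₂0 i < k₂M i
  cs₁ : ℝ
  cs₂ : ℝ
  T₀ : ℝ
  cs₁_pos : 0 < cs₁
  cs₂_pos : 0 < cs₂
  T₀_pos : 0 < T₀
  /-- neural network compensator -/
  μ : ∀ i, Fin (h i) → Z15
  ψ : ∀ i, Fin (h i) → ℝ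
  ψ_pos : ∀ i k, 0 < ψ i k
  Γ : ∀ i, Matrix (Fin (h i)) (Fin (h i)) ℝ
  Γ_pos : ∀ i, (Γ i).PosDef
  /-- disturbance compensator -/
  γ₃ : Fin n → ℝ
  γ₃_pos : ∀ i, 0 < γ₃ i

/-- The signals of a run of the closed loop. -/
structure Signals (n m : ℕ) (h : Fin n → ℕ) where
  /-- positions -/
  x₁ : Fin n → ℝ → E3
  /-- velocities -/
  x₂ : Fin n → ℝ → E3
  /-- estimates of the leader's position -/
  xhat : Fin n → ℝ → E3
  /-- reference positions -/
  xd : Fin n → ℝ → E3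
  /-- desired velocities -/
  vd : Fin n → ℝ → E3
  /-- weights of the networks -/
  What : ∀ i, ℝ → Matrix (Fin (h i)) (Fin 3) ℝ
  /-- disturbance bound estimates -/
  δhat : Fin n → ℝ → ℝ
  /-- state-dependent gains of the collision avoidance behavior -/
  lam : Fin n → ℝ → ℝ
  /-- the closest object: an obstacle or another agent -/
  near : Fin n → ℝ → Fin m ⊕ Fin n

section Run

variable {n m : ℕ} {h : Fin n → ℕ} (D : Design n h) (A : Agents n) (E : Environment m)
  (X : Signals n m h)

/-! ### Collision avoidance behavior -/

/-- Position of an object (obstacle or agent) at time `t`. -/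
def objPos (t : ℝ) : Fin m ⊕ Fin n → E3
  | Sum.inl k => E.obs k t
  | Sum.inr l => X.x₁ l t

/-- Velocity of an object (obstacle or agent) at time `t`. -/
def objVel (t : ℝ) : Fin m ⊕ Fin n → E3
  | Sum.inl k => deriv (E.obs k) t
  | Sum.inr l => X.x₂ l t

/-- `X.near i t` is an object closest to agent `i`, other than the agent itself. -/
def IsNearest (i : Fin n) (t : ℝ) : Prop :=
  X.near i t ≠ Sum.inr i ∧
    ∀ q : Fin m ⊕ Fin n, q ≠ Sum.inr i →
      ‖X.x₁ i t - objPos E X t (X.near i t)‖ ≤ ‖X.x₁ i t - objPos E X t q‖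

/-- Position of agent `i` relative to the closest object. -/
def relObj (i : Fin n) (t : ℝ) : E3 := X.x₁ i t - objPos E X t (X.near i t)

/-- Velocity of the object closest to agent `i`. -/
def velObj (i : Fin n) (t : ℝ) : E3 := objVel E X t (X.near i t)

/-- The pseudoinverse of the row vector `pᵀ` (it is `0` for `p = 0`). -/
def pinv (p : E3) : E3 := (‖p‖ ^ 2)⁻¹ • p

/-- The collision avoidance task error `d² / 2 - ‖x_{i1} - x_i^o‖² / 2`. -/
def errObj (i : Fin n) (t : ℝ) : ℝ := D.d ^ 2 / 2 - ‖relObj E X i t‖ ^ 2 / 2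

/-- Time derivative of the collision avoidance task error. -/
def errObjDot (i : Fin n) (t : ℝ) : ℝ :=
  -(inner ℝ (relObj E X i t) (X.x₂ i t - velObj E X i t))

/-- `α_{io}`. -/
def alphaObj (i : Fin n) (t : ℝ) : ℝ :=
  D.alpha (D.taskSigma (errObjDot E X i t) (errObj D E X i t)) (errObj D E X i t)

/-- The desired collision avoidance velocity. -/
def velAvoid (i : Fin n) (t : ℝ) : E3 :=
  (X.lam i t * alphaObj D E X i t + inner ℝ (relObj E X i t) (velObj E X i t)) •
    pinv (relObj E X i t)

/-! ### Estimator and cooperative behavior -/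

/-- `x̂_{i1} - x_o`. -/
def estErr (i : Fin n) (t : ℝ) : E3 := X.xhat i t - E.leader t

/-- The consensus error `∑_j a_{ij} (x̄_{i1} - x̄_{j1})`, the leader included. -/
def consErr (i : Fin n) (t : ℝ) : E3 :=
  ∑ l, D.a i l • (estErr E X i t - estErr E X l t) + D.b i • estErr E X i t

/-- Right-hand side of the estimator, `ξ` being the value taken for the sign term. -/
def estField (i : Fin n) (t : ℝ) (ξ : Fin 3 → ℝ) : E3 :=
  WithLp.toLp 2 fun j =>
    -D.K₁ * spow (consErr D E X i t j) D.p₁ - D.K₂ * spow (consErr D E X i t j) D.p₂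
      - D.K₃ * ξ j

/-- Position of agent `i` relative to its estimate of the leader. -/
def relLead (i : Fin n) (t : ℝ) : E3 := X.x₁ i t - X.xhat i t

/-- The cooperative tracking error `d_{i0}² / 2 - ‖x_{i1} - x̂_{i1}‖² / 2`. -/
def errLead (i : Fin n) (t : ℝ) : ℝ := D.d₀ i ^ 2 / 2 - ‖relLead X i t‖ ^ 2 / 2

/-- Time derivative of the cooperative tracking error. -/
def errLeadDot (i : Fin n) (t : ℝ) : ℝ :=
  -(inner ℝ (relLead X i t) (X.x₂ i t - deriv (X.xhat i) t))

/-- `α_{if}`. -/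
def alphaLead (i : Fin n) (t : ℝ) : ℝ :=
  D.alpha (D.taskSigma (errLeadDot X i t) (errLead D X i t)) (errLead D X i t)

/-- The desired cooperative velocity. -/
def velCoop (i : Fin n) (t : ℝ) : E3 :=
  (D.lamf * alphaLead D X i t + inner ℝ (relLead X i t) (deriv (X.xhat i) t)) •
    pinv (relLead X i t)

/-! ### Merged desired velocity -/

/-- Rotation about the `x`-axis. -/
def rotX (s : ℝ) : Matrix (Fin 3) (Fin 3) ℝ :=
  !![1, 0, 0; 0, Real.cos s, -Real.sin s; 0, Real.sin s, Real.cos s]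

/-- Rotation about the `y`-axis. -/
def rotY (s : ℝ) : Matrix (Fin 3) (Fin 3) ℝ :=
  !![Real.cos s, 0, Real.sin s; 0, 1, 0; -Real.sin s, 0, Real.cos s]

/-- Rotation about the `z`-axis. -/
def rotZ (s : ℝ) : Matrix (Fin 3) (Fin 3) ℝ :=
  !![Real.cos s, -Real.sin s, 0; Real.sin s, Real.cos s, 0; 0, 0, 1]

/-- The robust term that is added at local minima. -/
def velRobust (i : Fin n) (t : ℝ) : E3 :=
  ∫ s in t..(t + 1), D.δd • WithLp.toLp 2
    ((rotZ (D.θ i t 2) * rotY (D.θ i t 1) * rotX (D.θ i t 0)).mulVec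
      (WithLp.ofLp (‖relObj E X i s‖⁻¹ • relObj E X i s)))

open Classical in
/-- The merged desired velocity: the cooperative velocity is projected to the null space of the
collision avoidance task. -/
def velMerged (i : Fin n) (t : ℝ) : E3 :=
  let base := velAvoid D E X i t + (velCoop D X i t
    - inner ℝ (relObj E X i t) (velCoop D X i t) • pinv (relObj E X i t))
  if ‖velAvoid D E X i t + velCoop D X i t‖ ≠ 0 then base else base + velRobust D E X i t

/-- `v` is an admissible desired velocity of agent `i` at time `t`: the merged velocity; outside
the repulsive zone, where the collision avoidance task may be inactive, also the cooperative
velocity is admitted. -/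
def IsDesiredVelocity (i : Fin n) (t : ℝ) (v : E3) : Prop :=
  v = velMerged D E X i t ∨ (D.d < ‖relObj E X i t‖ ∧ v = velCoop D X i t)

/-! ### Tracking controller -/

/-- Position tracking error. -/
def posErr (i : Fin n) (t : ℝ) : E3 := X.x₁ i t - X.xd i t

/-- Velocity tracking error. -/
def velErr (i : Fin n) (t : ℝ) : E3 := X.x₂ i t - X.vd i t

/-- The sliding mode `S_i` at time `t`. -/
def S (i : Fin n) (t : ℝ) : E3 := D.slide (posErr X i t) (velErr X i t)

/-- The value of the sliding mode `S_i` at time `t` in Filippov's sense. -/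
def SF (i : Fin n) (t : ℝ) : E3 := D.slideReg (posErr X i t) (velErr X i t)

/-- The vector `α_i` of the position tracking error. -/
def alphaTrack (i : Fin n) (t : ℝ) : E3 :=
  WithLp.toLp 2 fun j => D.alpha (D.σ₁ (posErr X i t j) (velErr X i t j)) (posErr X i t j)

/-- The sigmoid gain `k_{1i}`. -/
def k₁ (i : Fin n) (t : ℝ) : ℝ :=
  D.k₁0 i + (D.k₁M i - D.k₁0 i) / (Real.exp (-D.cs₁ * (t - D.T₀)) + 1)

/-- The sigmoid gain `k_{2i}`. -/
def k₂ (i : Fin n) (t : ℝ) : ℝ :=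
  D.k₂0 i + (D.k₂M i - D.k₂0 i) / (Real.exp (-D.cs₂ * (t - D.T₀)) + 1)

/-- The Gaussian basis functions. -/
def rbf (i : Fin n) (z : Z15) (k : Fin (h i)) : ℝ :=
  Real.exp (-(‖z - D.μ i k‖ ^ 2) / D.ψ i k ^ 2)

/-- The network input: `x_{i1}`, `x_{i2}`, the derivative of the desired velocity, the derivative
of the position tracking error (which is the velocity tracking error), and the time derivative of
`α_i` along the run. -/
def netInput (i : Fin n) (t : ℝ) : Z15 :=
  WithLp.toLp 2 fun q =>
    (![fun j => X.x₁ i t j, fun j => X.x₂ i t j, fun j => deriv (X.vd i) t j,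
      fun j => velErr X i t j,
      fun j => deriv (fun s => D.alphaReg (posErr X i s j)) t] : Fin 5 → Fin 3 → ℝ) q.1 q.2

/-- The lumped uncertainty `F_i` as a function on `ℝ¹⁵`. -/
def lumped (i : Fin n) (z : Z15) : E3 :=
  WithLp.toLp 2 fun j =>
    A.f i (WithLp.toLp 2 fun l => z (0, l), WithLp.toLp 2 fun l => z (1, l)) j
      + (-(z (2, j)) + D.c₁ * z (3, j) + D.c₂ * z (4, j))

/-- The approximation error `ε_i = F_i(z) - Wᵀ φ_i(z)` of the network with weights `W`. -/
def approxErr (i : Fin n) (W : Matrix (Fin (h i)) (Fin 3) ℝ) (z : Z15) : E3 :=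
  lumped D A i z - WithLp.toLp 2 (W.transpose.mulVec (rbf D i z))

/-- The composite control: reaching law, network compensator and disturbance compensator, `ξ`
being the value taken for `sgn S_i`. -/
def control (i : Fin n) (t : ℝ) (ξ : Fin 3 → ℝ) : E3 :=
  WithLp.toLp 2 fun j =>
    (-(k₁ D i t) * spow (SF D X i t j) D.γ₁ - k₂ D i t * spow (SF D X i t j) D.γ₂)
      - (X.What i t).transpose.mulVec (rbf D i (netInput D X i t)) j
      - X.δhat i t * ξ j

/-- `X` is a run of the closed loop on `[0, ∞)`. Differential equations hold almost everywhere
for absolutely continuous functions; the discontinuous terms are taken in Filippov's sense. -/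
structure IsClosedLoop : Prop where
  near_meas : ∀ i, Measurable (X.near i)
  near_spec : ∀ i t, 0 ≤ t → IsNearest E X i t
  lam_pos : ∀ i t, 0 ≤ t → 0 < X.lam i t
  /-- the estimators -/
  xhat_ac : ∀ i, LocAC (X.xhat i)
  xhat_ode : ∀ i, AETime fun t => ∃ ξ : Fin 3 → ℝ, (∀ j, ξ j ∈ SGN (consErr D E X i t j)) ∧
    HasDerivAt (X.xhat i) (estField D E X i t ξ) t
  /-- the desired velocities and the reference positions -/
  vd_spec : ∀ i, AETime fun t => IsDesiredVelocity D E X i t (X.vd i t)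
  vd_ac : ∀ i, PiecewiseLocAC (X.vd i)
  xd_ac : ∀ i, LocAC (X.xd i)
  xd_ode : ∀ i, AETime fun t => HasDerivAt (X.xd i) (X.vd i t) t
  /-- the agents under the composite control -/
  x₁_ac : ∀ i, LocAC (X.x₁ i)
  x₂_ac : ∀ i, LocAC (X.x₂ i)
  x₁_ode : ∀ i, AETime fun t => HasDerivAt (X.x₁ i) (X.x₂ i t) t
  x₂_ode : ∀ i, AETime fun t => ∃ ξ : Fin 3 → ℝ, (∀ j, ξ j ∈ SGN (SF D X i t j)) ∧
    HasDerivAt (X.x₂ i)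
      (control D X i t ξ + (A.f i (X.x₁ i t, X.x₂ i t) + A.dist i (X.x₁ i t, X.x₂ i t) t)) t
  /-- the adaptation laws -/
  What_ac : ∀ i k j, LocAC fun t => X.What i t k j
  What_ode : ∀ i, AETime fun t => ∀ k j, HasDerivAt (fun s => X.What i s k j)
    ((D.Γ i).mulVec (rbf D i (netInput D X i t)) k * SF D X i t j) t
  δhat_ac : ∀ i, LocAC (X.δhat i)
  δhat_ode : ∀ i, AETime fun t => HasDerivAt (X.δhat i) (D.γ₃ i * ∑ j, |SF D X i t j|) t

/-! ### Lower bounds for the collision avoidance gain -/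

/-- Auxiliary constants of the bounds `λ_{io1}` and `λ_{io2}`. -/
structure GainConsts (n : ℕ) where
  γo : Fin n → ℝ
  γε : Fin n → ℝ
  lamv : Fin n → ℝ
  γf : ℝ
  L₀ : ℝ
  /-- the largest speed of the object closest to agent `i` -/
  Lobj : Fin n → ℝ

variable (G : GainConsts n)

/-- The constraints on the auxiliary constants. -/
structure GainConsts.Admissible : Prop where
  γε_pos : ∀ i, 0 < G.γε i
  lamv_pos : ∀ i, 0 < G.lamv i
  γf_pos : 0 < G.γf
  L₀_gt : D.φs < G.L₀
  L₀_obj : ∀ i, |errObj D E X i 0| ≤ G.L₀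
  L₀_lead : ∀ i, |errLead D X i 0| ≤ G.L₀
  γo_ge : ∀ i, D.d₀ i * G.γf * G.L₀ / (D.d * D.φs) + G.γε i ≤ G.γo i
  Lobj_sup : ∀ i, IsLUB ((fun t => ‖velObj E X i t‖) '' Ici 0) (G.Lobj i)

/-- Componentwise signed power of a vector. -/
def vpow (x : E3) (p : ℝ) : E3 := WithLp.toLp 2 fun j => spow (x j) p

/-- `η̄_{i1}(0)` for `p = r₃ / r₄` and `η̄_{i2}(0)` for `p = r₅ / r₆`. -/
def etaBar (i : Fin n) (p : ℝ) : E3 :=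
  ∑ l, D.a i l • (vpow (estErr E X i 0) p + vpow (estErr E X l 0) p)
    + D.b i • vpow (estErr E X i 0) p

/-- `L_{i x̂}`. -/
def Lhat (i : Fin n) : ℝ :=
  D.K₁ * ‖etaBar D E X i D.p₁‖ + D.K₂ * ‖etaBar D E X i D.p₂‖ + √3 * D.K₃

/-- `L_{iof}`. -/
def Liof (i : Fin n) : ℝ := √((D.d ^ 2 + 2 * G.L₀) / (D.d₀ i ^ 2 - 2 * D.φs))

/-- `L_{io}`. -/
def Lio : ℝ := √(D.d ^ 2 + 2 * G.L₀)

/-- `L_{if}`. -/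
def Lif (i : Fin n) : ℝ := √(D.d₀ i ^ 2 + 2 * G.L₀)

/-- `λ_{io1}`, with `φ_s^* = (β₁ φ_s^{r₁} + β₂ φ_s^{r₂})^{r₀}`. -/
def lam₁ (i : Fin n) : ℝ :=
  G.γo i * D.lamf * Liof D G i / G.γε i
    + G.γo i * Lio D G * Lhat D E X i / (D.terminal D.φs * G.γε i)
    + G.γf * Lif D G i * (Lhat D E X i + G.Lobj i) / (D.terminal D.φs * G.γε i)
    + G.γo i * G.lamv i / G.γε i

/-- `λ_{io2}`, with `L₀^* = (β₁ L₀^{r₁} + β₂ L₀^{r₂})^{r₀}`. -/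
def lam₂ (i : Fin n) : ℝ :=
  G.γo i * D.lamf * Liof D G i * D.terminal G.L₀ / (G.γε i * D.terminal D.φs)
    + G.γo i * Lio D G * Lhat D E X i / (D.terminal D.φs * G.γε i)
    + G.γf * Lif D G i * (Lhat D E X i + G.Lobj i) * G.L₀ / (D.terminal D.φs * D.φs * G.γε i)
    + G.γo i * G.lamv i / G.γε i

/-- `Υ_{1i}`. -/
def Ups₁ (i : Fin n) (t : ℝ) : ℝ := ‖pinv (relObj E X i t)‖ ^ 2 * alphaObj D E X i t ^ 2

/-- `Υ_{2i}`. -/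
def Ups₂ (i : Fin n) (t : ℝ) : ℝ :=
  -2 * ‖pinv (relObj E X i t)‖ * |alphaObj D E X i t| *
    (‖X.x₂ i t‖ + D.c₁ * ‖posErr X i t‖ + D.c₂ * ‖alphaTrack D X i t‖)

/-- `Υ_{3i}`. -/
def Ups₃ (i : Fin n) (t : ℝ) : ℝ :=
  -(‖X.x₂ i t‖ ^ 2 + D.c₁ ^ 2 * ‖posErr X i t‖ ^ 2 + D.c₂ ^ 2 * ‖alphaTrack D X i t‖ ^ 2
    + 2 * D.c₁ * ‖X.x₂ i t‖ * ‖posErr X i t‖ + 2 * D.c₂ * ‖X.x₂ i t‖ * ‖alphaTrack D X i t‖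
    + 2 * D.c₁ * D.c₂ * ‖posErr X i t‖ * ‖alphaTrack D X i t‖)

/-- The state-dependent bound `λ_i^*`. Where `Υ_{1i} = 0`, the term of the desired velocity that
is multiplied by the gain vanishes, and the gain is not constrained by this bound. -/
def lamStar (i : Fin n) (t : ℝ) : ℝ :=
  (-(Ups₂ D E X i t) + √(Ups₂ D E X i t ^ 2 - 4 * Ups₁ D E X i t * Ups₃ D X i t))
    / (2 * Ups₁ D E X i t)

end Run

end MultiAgent

end

noncomputable section

namespace MultiAgent

open Filter Topology

/-! The proof is a Lyapunov argument for the sliding mode of one agent, followed by a Barbalat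
argument.

After the last switching time of the desired velocity, the Filippov value `s = SF` of the sliding
mode is absolutely continuous and satisfies `s_j' = ϱ (-k₁ s_j^[γ₁] - k₂ s_j^[γ₂] - w_j·φ - δ̂ ξ_j +
Δ_j)`, where `w_j` is the `j`-th column of the weights, `ξ_j ∈ SGN s_j`, and `Δ` is the lumped
uncertainty plus the disturbance. The weights are compared with `0` rather than with the ideal
weights, which depend on time without any regularity: the lumped uncertainty is continuous, hence
bounded on the compact set that contains the network inputs, so that all of `Δ` is bounded by one
constant `M`, which `δ̂` compensates. With `V = Σ_j (s_j²/(2ϱ) + w_jᵀ Γ⁻¹ w_j/2) + (δ̂ - M)²/(2γ₃)`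
the adaptation laws cancel the terms in `w` and `δ̂`, and `V' ≤ -k₁0 |s_j|^(1+γ₁)` for each `j`
(`tendsto_zero_of_adaptive_reaching`).

Hence `V` is bounded, so `s`, `w`, `δ̂` and then `s'` are bounded. A Lipschitz `s` that stays away
from zero at arbitrarily late times would use up more of `V` than is left, so `s → 0`
(`tendsto_zero_of_dissipation`). Finally, `S` is dominated coordinatewise by `SF`.

The regularity needed for this rests on `alphaReg_eq`: the two branches of `α` match at `±φs`, and
the terminal function is used only away from its singularity at `0`. -/

/-! ### Absolutely continuous functions on a half-line -/

/-- Local absolute continuity on `[t₀, ∞)`. -/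
def ACFrom {X : Type*} [PseudoMetricSpace X] (t₀ : ℝ) (g : ℝ → X) : Prop :=
  ∀ b : ℝ, t₀ ≤ b → AbsolutelyContinuousOnInterval g t₀ b

/-- The image of an absolutely continuous function under a map that is Lipschitz on its range. -/
theorem absolutelyContinuousOnInterval_of_dist_le {X Y : Type*} [PseudoMetricSpace X]
    [PseudoMetricSpace Y] {f : ℝ → X} {g : ℝ → Y} {a b K : ℝ} (hK : 0 ≤ K)
    (hf : AbsolutelyContinuousOnInterval f a b)
    (h : ∀ x ∈ uIcc a b, ∀ y ∈ uIcc a b, dist (g x) (g y) ≤ K * dist (f x) (f y)) :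
    AbsolutelyContinuousOnInterval g a b := by
  rw [absolutelyContinuousOnInterval_iff] at hf ⊢
  intro ε hε
  -- `K + 1` instead of `K` covers the case `K = 0`.
  obtain ⟨δ, hδ, H⟩ := hf (ε / (K + 1)) (by positivity)
  refine ⟨δ, hδ, fun E hE hlt => ?_⟩
  have h1 := H E hE hlt
  calc ∑ i ∈ Finset.range E.1, dist (g (E.2 i).1) (g (E.2 i).2)
      ≤ ∑ i ∈ Finset.range E.1, K * dist (f (E.2 i).1) (f (E.2 i).2) := by
        refine Finset.sum_le_sum fun i hi => ?_
        exact h _ (hE.1 i hi).1 _ (hE.1 i hi).2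
    _ = K * ∑ i ∈ Finset.range E.1, dist (f (E.2 i).1) (f (E.2 i).2) := by
        rw [Finset.mul_sum]
    _ ≤ K * (ε / (K + 1)) := by gcongr
    _ < ε := by
        rw [← mul_div_assoc, div_lt_iff₀ (by positivity)]
        nlinarith

theorem absolutelyContinuousOnInterval_sum {ι : Type*} (s : Finset ι) {f : ι → ℝ → ℝ} {a b : ℝ}
    (hf : ∀ i ∈ s, AbsolutelyContinuousOnInterval (f i) a b) :
    AbsolutelyContinuousOnInterval (fun t => ∑ i ∈ s, f i t) a b := by
  classical
  induction s using Finset.induction_on with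
  | empty =>
    simpa using (LipschitzWith.const (0 : ℝ)).lipschitzOnWith.absolutelyContinuousOnInterval
  | insert i s hi ih =>
    simp only [Finset.sum_insert hi]
    exact (hf i (by simp)).add (ih fun j hj => hf j (by simp [hj]))

theorem absolutelyContinuousOnInterval_const (c a b : ℝ) :
    AbsolutelyContinuousOnInterval (fun _ : ℝ => c) a b :=
  (LipschitzWith.const c).lipschitzOnWith.absolutelyContinuousOnInterval

theorem ACFrom.mono {X : Type*} [PseudoMetricSpace X] {g : ℝ → X} {t₀ t₁ : ℝ}
    (hg : ACFrom t₀ g) (h : t₀ ≤ t₁) : ACFrom t₁ g := fun b hb =>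
  (hg b (h.trans hb)).mono (by
    rw [uIcc_of_le hb, uIcc_of_le (h.trans hb)]; exact Icc_subset_Icc_left h)

theorem ACFrom.on {X : Type*} [PseudoMetricSpace X] {g : ℝ → X} {t₀ a b : ℝ}
    (hg : ACFrom t₀ g) (h : t₀ ≤ a) (hab : a ≤ b) : AbsolutelyContinuousOnInterval g a b :=
  hg.mono h b hab

/-- An absolutely continuous function whose derivative is at most `C` almost everywhere grows at
most linearly with slope `C`. -/
theorem sub_le_of_ae_hasDerivAt_le {f : ℝ → ℝ} {a b C : ℝ} (hab : a ≤ b)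
    (hf : AbsolutelyContinuousOnInterval f a b)
    (h : ∀ᵐ t : ℝ, t ∈ Icc a b → ∃ f', HasDerivAt f f' t ∧ f' ≤ C) :
    f b - f a ≤ C * (b - a) := by
  rw [← hf.integral_deriv_eq_sub]
  have h2 : ∫ _ in a..b, C = C * (b - a) := by
    rw [intervalIntegral.integral_const, smul_eq_mul, mul_comm]
  rw [← h2]
  refine intervalIntegral.integral_mono_ae_restrict hab hf.intervalIntegrable_deriv
    intervalIntegrable_const ?_
  rw [EventuallyLE, ae_restrict_iff' measurableSet_Icc]
  filter_upwards [h] with t ht hmem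
  obtain ⟨f', hd, hle⟩ := ht hmem
  rw [hd.deriv]
  exact hle

/-- A form of Barbalat's lemma: a Lipschitz function that is dissipated by a nonnegative storage
function tends to zero. -/
theorem tendsto_zero_of_dissipation {s V : ℝ → ℝ} {t₀ L a γ : ℝ} (ha : 0 < a) (hγ : 0 < γ)
    (hs : ACFrom t₀ s) (hV : ACFrom t₀ V) (hV0 : ∀ t, 0 ≤ V t)
    (hs' : ∀ᵐ t : ℝ, t₀ ≤ t → ∃ s', HasDerivAt s s' t ∧ |s'| ≤ L)
    (hV' : ∀ᵐ t : ℝ, t₀ ≤ t → ∃ v', HasDerivAt V v' t ∧ v' ≤ -(a * (|s t| * |s t| ^ γ))) :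
    Tendsto s atTop (𝓝 0) := by
  have hanti : ∀ x y, t₀ ≤ x → x ≤ y → V y ≤ V x := fun x y hx hxy => by
    have := sub_le_of_ae_hasDerivAt_le (C := 0) hxy (hV.on hx hxy) (by
      filter_upwards [hV'] with t ht hmem
      obtain ⟨v', hd, hle⟩ := ht (hx.trans hmem.1)
      exact ⟨v', hd, hle.trans (neg_nonpos.2 (by positivity))⟩)
    linarith
  have hlip : ∀ x y, t₀ ≤ x → x ≤ y → |s y - s x| ≤ L * (y - x) := fun x y hx hxy => by
    have h1 := sub_le_of_ae_hasDerivAt_le (C := L) hxy (hs.on hx hxy) (by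
      filter_upwards [hs'] with t ht hmem
      obtain ⟨v', hd, hle⟩ := ht (hx.trans hmem.1)
      exact ⟨v', hd, (le_abs_self _).trans hle⟩)
    have h2 := sub_le_of_ae_hasDerivAt_le (C := L) hxy (hs.on hx hxy).neg (by
      filter_upwards [hs'] with t ht hmem
      obtain ⟨v', hd, hle⟩ := ht (hx.trans hmem.1)
      exact ⟨-v', hd.neg, (neg_le_abs _).trans hle⟩)
    simp only [Pi.neg_apply] at h2
    exact abs_le.2 ⟨by linarith, h1⟩
  -- The sign of `L` is read off from the Lipschitz estimate itself; it makes `L + 1` positive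
  -- below.
  have hL : 0 ≤ L := by
    have := (abs_nonneg _).trans (hlip t₀ (t₀ + 1) le_rfl (by linarith))
    linarith
  have hbdd : BddBelow (V '' Ici t₀) := ⟨0, by rintro _ ⟨t, -, rfl⟩; exact hV0 t⟩
  rw [Metric.tendsto_atTop]
  intro ε hε
  -- If `|s t| ≥ ε`, then `|s| ≥ ε / 2` on `[t, t + τ]`, because `L * τ ≤ ε / 2`. There `V`
  -- decreases at rate at least `c`, hence by at least `c * τ`. Since `T` is chosen with `V T`
  -- within `c * τ` of the infimum, this is impossible for `t ≥ T`.
  set τ := ε / (2 * (L + 1)) with hτdef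
  have hτ : 0 < τ := by positivity
  set c := a * (ε / 2 * (ε / 2) ^ γ) with hcdef
  have hc : 0 < c := by positivity
  obtain ⟨_, ⟨T, hT, rfl⟩, hVT⟩ := exists_lt_of_csInf_lt
    (show (V '' Ici t₀).Nonempty from ⟨_, t₀, self_mem_Ici, rfl⟩)
    (lt_add_of_pos_right (sInf (V '' Ici t₀)) (mul_pos hc hτ))
  refine ⟨T, fun t ht => ?_⟩
  rw [Real.dist_eq, sub_zero]
  by_contra! hge
  have ht₀ : t₀ ≤ t := le_trans hT ht
  have htτ : t ≤ t + τ := by linarith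
  have hlow : ∀ r ∈ Icc t (t + τ), ε / 2 ≤ |s r| := fun r hr => by
    have h1 := hlip t r ht₀ hr.1
    have h2 : L * (r - t) ≤ ε / 2 := by
      have h3 : L * (r - t) ≤ (L + 1) * τ := by
        have := hr.2
        have h4 := hr.1
        gcongr
        · linarith
        · linarith
      have h5 : (L + 1) * τ = ε / 2 := by rw [hτdef]; field_simp
      linarith
    have h3 : |s t| - |s r| ≤ |s r - s t| := by
      rw [abs_sub_comm]; exact abs_sub_abs_le_abs_sub _ _
    linarith
  have hdrop := sub_le_of_ae_hasDerivAt_le (C := -c) htτ (hV.on ht₀ htτ) (by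
    filter_upwards [hV'] with r hr hmem
    obtain ⟨v', hd, hle⟩ := hr (ht₀.trans hmem.1)
    refine ⟨v', hd, hle.trans (neg_le_neg ?_)⟩
    have := hlow r hmem
    rw [hcdef]
    gcongr)
  have h1 := hanti T t hT ht
  have h2 : sInf (V '' Ici t₀) ≤ V (t + τ) := csInf_le hbdd ⟨_, ht₀.trans htτ, rfl⟩
  have h3 : -c * (t + τ - t) = -(c * τ) := by ring
  linarith

/-! ### Quadratic forms -/

/-- Young's inequality for dual quadratic forms: expand the form of `Γ⁻¹` at `u ± Γ φ`, where it is
nonnegative. It bounds the network output by the weight term of the Lyapunov function. -/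
theorem abs_dotProduct_le_of_posDef {κ : Type*} [Fintype κ] [DecidableEq κ] {Γ : Matrix κ κ ℝ}
    (hΓ : Γ.PosDef) (u φ : κ → ℝ) :
    |u ⬝ᵥ φ| ≤ (u ⬝ᵥ Γ⁻¹.mulVec u + φ ⬝ᵥ Γ.mulVec φ) / 2 := by
  have hdet : IsUnit Γ.det := hΓ.det_pos.ne'.isUnit
  have hN := hΓ.inv.posSemidef
  have hsym : Γ⁻¹.transpose = Γ⁻¹ := by simpa using hN.isHermitian.eq
  have hNΓ : Γ⁻¹.mulVec (Γ.mulVec φ) = φ := by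
    rw [Matrix.mulVec_mulVec, Matrix.nonsing_inv_mul _ hdet, Matrix.one_mulVec]
  have hcross : (Γ.mulVec φ) ⬝ᵥ Γ⁻¹.mulVec u = u ⬝ᵥ φ := by
    rw [Matrix.dotProduct_mulVec, ← Matrix.mulVec_transpose, hsym, hNΓ, dotProduct_comm]
  have hself : (Γ.mulVec φ) ⬝ᵥ φ = φ ⬝ᵥ Γ.mulVec φ := dotProduct_comm _ _
  have h1 := hN.dotProduct_mulVec_nonneg (u - Γ.mulVec φ)
  have h2 := hN.dotProduct_mulVec_nonneg (u + Γ.mulVec φ)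
  simp only [star_trivial, Matrix.mulVec_sub, Matrix.mulVec_add, dotProduct_sub, dotProduct_add,
    sub_dotProduct, add_dotProduct, hNΓ, hcross, hself] at h1 h2
  rw [abs_le]
  constructor <;> linarith

/-- By symmetry of `Γ⁻¹` both product-rule terms agree, and `Γ⁻¹` cancels the gain `Γ` of the
adaptation law. What remains is the cross term between sliding mode and network. -/
theorem hasDerivAt_dotProduct_inv_mulVec {κ : Type*} [Fintype κ] [DecidableEq κ]
    {Γ : Matrix κ κ ℝ} (hΓ : Γ.PosDef) {u : ℝ → κ → ℝ} {φ : κ → ℝ} {s t : ℝ}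
    (hu : ∀ k, HasDerivAt (fun r => u r k) (Γ.mulVec φ k * s) t) :
    HasDerivAt (fun r => u r ⬝ᵥ Γ⁻¹.mulVec (u r)) (2 * s * (u t ⬝ᵥ φ)) t := by
  have hdet : IsUnit Γ.det := hΓ.det_pos.ne'.isUnit
  have hsym : Γ⁻¹.transpose = Γ⁻¹ := by simpa using hΓ.inv.posSemidef.isHermitian.eq
  have hNΓ : Γ⁻¹.mulVec (Γ.mulVec φ) = φ := by
    rw [Matrix.mulVec_mulVec, Matrix.nonsing_inv_mul _ hdet, Matrix.one_mulVec]
  have hcross : (Γ.mulVec φ) ⬝ᵥ Γ⁻¹.mulVec (u t) = u t ⬝ᵥ φ := by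
    rw [Matrix.dotProduct_mulVec, ← Matrix.mulVec_transpose, hsym, hNΓ, dotProduct_comm]
  have hu' : HasDerivAt u (s • Γ.mulVec φ) t := by
    rw [hasDerivAt_pi]
    intro k
    simpa [mul_comm] using hu k
  have hM : ∀ k, HasDerivAt (fun r => Γ⁻¹.mulVec (u r) k) (Γ⁻¹.mulVec (s • Γ.mulVec φ) k) t := by
    intro k
    simp only [Matrix.mulVec, dotProduct]
    exact HasDerivAt.fun_sum fun l _ => ((hasDerivAt_pi.1 hu' l).const_mul _)
  have := HasDerivAt.fun_sum (u := Finset.univ)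
    (fun k _ => (hasDerivAt_pi.1 hu' k).mul (hM k))
  refine this.congr_deriv ?_
  rw [Finset.sum_add_distrib]
  change (s • Γ.mulVec φ) ⬝ᵥ Γ⁻¹.mulVec (u t) + u t ⬝ᵥ Γ⁻¹.mulVec (s • Γ.mulVec φ) = _
  rw [Matrix.mulVec_smul, hNΓ, smul_dotProduct, dotProduct_smul, hcross]
  simp only [smul_eq_mul]
  ring

theorem dotProduct_mulVec_le_sum_abs {κ : Type*} [Fintype κ] (Γ : Matrix κ κ ℝ) {φ : κ → ℝ}
    (hφ : ∀ k, |φ k| ≤ 1) : φ ⬝ᵥ Γ.mulVec φ ≤ ∑ k, ∑ l, |Γ k l| := by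
  simp only [dotProduct, Matrix.mulVec, Finset.mul_sum]
  refine Finset.sum_le_sum fun k _ => Finset.sum_le_sum fun l _ => ?_
  refine (le_abs_self _).trans ?_
  rw [abs_mul, abs_mul]
  calc |φ k| * (|Γ k l| * |φ l|) ≤ 1 * (|Γ k l| * 1) := by
        gcongr
        · exact hφ k
        · exact hφ l
    _ = |Γ k l| := by ring

/-! ### Signed powers -/

theorem abs_sign_le_one (x : ℝ) : |Real.sign x| ≤ 1 := by
  rcases Real.sign_apply_eq x with h | h | h <;> simp [h]

theorem abs_spow_le (x p : ℝ) : |spow x p| ≤ |x| ^ p := by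
  rw [spow, abs_mul, abs_of_nonneg (by positivity)]
  exact mul_le_of_le_one_right (by positivity) (abs_sign_le_one x)

theorem mul_spow (x p : ℝ) : x * spow x p = |x| * |x| ^ p := by
  have : x * Real.sign x = |x| := by
    rcases lt_trichotomy x 0 with hx | hx | hx
    · rw [Real.sign_of_neg hx, abs_of_neg hx]; ring
    · simp [hx]
    · rw [Real.sign_of_pos hx, abs_of_pos hx]; ring
  rw [spow, ← this]; ring

/-- Multiplication by `s` removes the ambiguity of the Filippov sign at `s = 0`. -/
theorem mul_eq_abs_of_mem_SGN {s ξ : ℝ} (h : ξ ∈ SGN s) : s * ξ = |s| := by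
  obtain ⟨hp, hn, -⟩ := h
  rcases lt_trichotomy s 0 with hs | hs | hs
  · rw [hn hs, abs_of_neg hs]; ring
  · simp [hs]
  · rw [hp hs, abs_of_pos hs]; ring

/-! ### Adaptive reaching laws -/

/-- Lyapunov function of the adaptive reaching law, for the comparison weights `0` and the
comparison bound `M`. -/
def lyap {ι κ : Type*} [Fintype ι] [Fintype κ] [DecidableEq κ] (Γ : Matrix κ κ ℝ) (ϱ g M : ℝ)
    (s : ι → ℝ → ℝ) (w : κ → ι → ℝ → ℝ) (δ : ℝ → ℝ) (t : ℝ) : ℝ :=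
  ∑ j, (s j t * s j t / (2 * ϱ) + ((fun k => w k j t) ⬝ᵥ Γ⁻¹.mulVec fun k => w k j t) / 2)
    + (δ t - M) * (δ t - M) / (2 * g)

section Lyapunov

variable {ι κ : Type*} [Fintype ι] [Fintype κ] [DecidableEq κ] {Γ : Matrix κ κ ℝ} {ϱ g M : ℝ}
  {s : ι → ℝ → ℝ} {w : κ → ι → ℝ → ℝ} {δ : ℝ → ℝ}

omit [Fintype ι] in
theorem lyap_summand_nonneg (hΓ : Γ.PosDef) (hϱ : 0 < ϱ) (t : ℝ) (j : ι) :
    0 ≤ s j t * s j t / (2 * ϱ) + ((fun k => w k j t) ⬝ᵥ Γ⁻¹.mulVec fun k => w k j t) / 2 := by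
  have h1 : 0 ≤ s j t * s j t / (2 * ϱ) := div_nonneg (mul_self_nonneg _) (by positivity)
  have h2 := hΓ.inv.posSemidef.dotProduct_mulVec_nonneg (fun k => w k j t)
  rw [star_trivial] at h2
  linarith

/-- Turns a bound on the Lyapunov function into bounds on the single variables; the discarded
summands are nonnegative. -/
theorem le_lyap (hΓ : Γ.PosDef) (hϱ : 0 < ϱ) (t : ℝ) (j : ι) :
    s j t * s j t / (2 * ϱ) + ((fun k => w k j t) ⬝ᵥ Γ⁻¹.mulVec fun k => w k j t) / 2
      + (δ t - M) * (δ t - M) / (2 * g) ≤ lyap Γ ϱ g M s w δ t := by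
  have := Finset.single_le_sum (f := fun j => s j t * s j t / (2 * ϱ)
    + ((fun k => w k j t) ⬝ᵥ Γ⁻¹.mulVec fun k => w k j t) / 2)
    (fun i _ => lyap_summand_nonneg hΓ hϱ t i) (Finset.mem_univ j)
  rw [lyap]
  linarith

theorem lyap_nonneg (hΓ : Γ.PosDef) (hϱ : 0 < ϱ) (hg : 0 < g) (t : ℝ) :
    0 ≤ lyap Γ ϱ g M s w δ t :=
  add_nonneg (Finset.sum_nonneg fun j _ => lyap_summand_nonneg hΓ hϱ t j)
    (div_nonneg (mul_self_nonneg _) (by positivity))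

theorem lyap_acFrom {t₀ : ℝ} (hs : ∀ j, ACFrom t₀ (s j)) (hw : ∀ k j, ACFrom t₀ (w k j))
    (hδ : ACFrom t₀ δ) : ACFrom t₀ (lyap Γ ϱ g M s w δ) := by
  intro b hb
  have hdiv : ∀ {f : ℝ → ℝ} (c : ℝ), AbsolutelyContinuousOnInterval f t₀ b →
      AbsolutelyContinuousOnInterval (fun t => f t / c) t₀ b := fun {f} c hf => by
    simpa [div_eq_inv_mul] using hf.const_mul c⁻¹
  have hδM : AbsolutelyContinuousOnInterval (fun t => δ t - M) t₀ b :=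
    (hδ b hb).sub (absolutelyContinuousOnInterval_const M t₀ b)
  refine AbsolutelyContinuousOnInterval.add
    (absolutelyContinuousOnInterval_sum _ fun j _ => ?_) (hdiv _ (hδM.mul hδM))
  refine AbsolutelyContinuousOnInterval.add (hdiv _ ((hs j b hb).mul (hs j b hb))) (hdiv _ ?_)
  simp only [dotProduct, Matrix.mulVec]
  exact absolutelyContinuousOnInterval_sum _ fun k _ => (hw k j b hb).mul
    (absolutelyContinuousOnInterval_sum _ fun l _ => (hw l j b hb).const_mul _)

/-- The normalizations `1 / (2ϱ)`, `Γ⁻¹ / 2` and `1 / (2g)` absorb the gains `ϱ`, `Γ` and `g` of the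
three equations. -/
theorem lyap_hasDerivAt (hΓ : Γ.PosDef) (hϱ : ϱ ≠ 0) (hg : g ≠ 0) {t : ℝ} {φ : κ → ℝ}
    {r : ι → ℝ} (hs : ∀ j, HasDerivAt (s j) (ϱ * r j) t)
    (hw : ∀ k j, HasDerivAt (w k j) (Γ.mulVec φ k * s j t) t)
    (hδ : HasDerivAt δ (g * ∑ j, |s j t|) t) :
    HasDerivAt (lyap Γ ϱ g M s w δ)
      (∑ j, (s j t * (r j + (fun k => w k j t) ⬝ᵥ φ) + (δ t - M) * |s j t|)) t := by
  have h1 := HasDerivAt.fun_sum (u := Finset.univ) fun j _ =>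
    (((hs j).mul (hs j)).div_const (2 * ϱ)).add
      ((hasDerivAt_dotProduct_inv_mulVec hΓ (u := fun t k => w k j t)
        (fun k => hw k j)).div_const 2)
  have h2 := (((hδ.sub_const M).mul (hδ.sub_const M)).div_const (2 * g))
  refine (h1.add h2).congr_deriv ?_
  rw [Finset.sum_add_distrib (f := fun j => s j t * (r j + (fun k => w k j t) ⬝ᵥ φ)),
    ← Finset.mul_sum]
  congr 1
  · refine Finset.sum_congr rfl fun j _ => ?_
    field_simp
    ring
  · field_simp
    ring

/-- Convergence of an adaptive reaching law, the uncertainty `Δ` being bounded by an unknown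
constant. -/
theorem tendsto_zero_of_adaptive_reaching {t₀ γ₁ γ₂ a₁ b₁ b₂ : ℝ} (hΓ : Γ.PosDef) (hϱ : 0 < ϱ)
    (hg : 0 < g) (hγ₁ : 0 < γ₁) (hγ₂ : 0 < γ₂) (ha₁ : 0 < a₁)
    (hs : ∀ j, ACFrom t₀ (s j)) (hw : ∀ k j, ACFrom t₀ (w k j)) (hδ : ACFrom t₀ δ)
    (h : ∀ᵐ t : ℝ, t₀ ≤ t → ∃ (φ : κ → ℝ) (ξ Δ : ι → ℝ) (k₁ k₂ : ℝ),
      (∀ k, |φ k| ≤ 1) ∧ (∀ j, ξ j ∈ SGN (s j t)) ∧ (∀ j, |Δ j| ≤ M) ∧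
      k₁ ∈ Icc a₁ b₁ ∧ k₂ ∈ Icc 0 b₂ ∧
      (∀ j, HasDerivAt (s j) (ϱ * (-k₁ * spow (s j t) γ₁ - k₂ * spow (s j t) γ₂
        - (fun k => w k j t) ⬝ᵥ φ - δ t * ξ j + Δ j)) t) ∧
      (∀ k j, HasDerivAt (w k j) (Γ.mulVec φ k * s j t) t) ∧
      HasDerivAt δ (g * ∑ j, |s j t|) t) (j : ι) :
    Tendsto (s j) atTop (𝓝 0) := by
  set V := lyap Γ ϱ g M s w δ with hVdef
  have hVac : ACFrom t₀ V := lyap_acFrom hs hw hδ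
  have hV0 : ∀ t, 0 ≤ V t := lyap_nonneg hΓ hϱ hg
  have hV' : ∀ᵐ t : ℝ, t₀ ≤ t →
      ∃ v', HasDerivAt V v' t ∧ v' ≤ -(a₁ * (|s j t| * |s j t| ^ γ₁)) := by
    filter_upwards [h] with t ht ht₀
    obtain ⟨φ, ξ, Δ, k₁, k₂, hφ, hξ, hΔ, hk₁, hk₂, hs', hw', hδ'⟩ := ht ht₀
    refine ⟨_, lyap_hasDerivAt hΓ hϱ.ne' hg.ne' hs' hw' hδ', ?_⟩
    -- The network terms cancel; `-δ * s * ξ = -δ * |s|` cancels the `δ * |s|` from the adaptation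
    -- of `δ`, whatever the sign of `δ`; the remaining `-M * |s|` absorbs `s * Δ`.
    have hterm : ∀ i, s i t * ((-k₁ * spow (s i t) γ₁ - k₂ * spow (s i t) γ₂
        - (fun k => w k i t) ⬝ᵥ φ - δ t * ξ i + Δ i) + (fun k => w k i t) ⬝ᵥ φ)
        + (δ t - M) * |s i t| ≤ -(a₁ * (|s i t| * |s i t| ^ γ₁)) := fun i => by
      have e1 := mul_spow (s i t) γ₁
      have e2 := mul_spow (s i t) γ₂
      have e3 := mul_eq_abs_of_mem_SGN (hξ i)
      have e4 : s i t * Δ i ≤ |s i t| * M := by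
        refine (le_abs_self _).trans ?_
        rw [abs_mul]
        gcongr
        exact hΔ i
      have e5 : a₁ * (|s i t| * |s i t| ^ γ₁) ≤ k₁ * (|s i t| * |s i t| ^ γ₁) := by
        gcongr
        exact hk₁.1
      have e6 : 0 ≤ k₂ * (|s i t| * |s i t| ^ γ₂) := mul_nonneg hk₂.1 (by positivity)
      calc _ = -(k₁ * (s i t * spow (s i t) γ₁)) - k₂ * (s i t * spow (s i t) γ₂)
            - δ t * (s i t * ξ i) + s i t * Δ i + (δ t - M) * |s i t| := by ring
        _ ≤ _ := by rw [e1, e2, e3]; linarith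
    refine (Finset.sum_le_sum fun i _ => hterm i).trans ?_
    rw [Finset.sum_neg_distrib, neg_le_neg_iff]
    exact Finset.single_le_sum (f := fun i => a₁ * (|s i t| * |s i t| ^ γ₁))
      (fun i _ => by positivity) (Finset.mem_univ j)
  have hVle : ∀ t, t₀ ≤ t → V t ≤ V t₀ := fun t ht => by
    have := sub_le_of_ae_hasDerivAt_le (C := 0) ht (hVac t ht) (by
      filter_upwards [hV'] with r hr hmem
      obtain ⟨v', hd, hle⟩ := hr hmem.1
      exact ⟨v', hd, hle.trans (neg_nonpos.2 (by positivity))⟩)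
    linarith
  set v := V t₀ with hv
  have hv0 : 0 ≤ v := hV0 t₀
  -- Bounds for `|s j|`, `|δ|` and `|w·φ|` that follow from `V ≤ v`; together they bound the
  -- derivative of `s j`.
  set σ := √(2 * ϱ * v)
  set δM := √(2 * g * v) + |M|
  set wM := v + (∑ k, ∑ l, |Γ k l|) / 2
  refine tendsto_zero_of_dissipation ha₁ hγ₁ (hs j) hVac hV0
    (L := ϱ * (b₁ * σ ^ γ₁ + b₂ * σ ^ γ₂ + wM + δM + M)) ?_ hV'
  filter_upwards [h] with t ht ht₀
  obtain ⟨φ, ξ, Δ, k₁, k₂, hφ, hξ, hΔ, hk₁, hk₂, hs', -, -⟩ := ht ht₀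
  refine ⟨_, hs' j, ?_⟩
  have hle : s j t * s j t / (2 * ϱ) + ((fun k => w k j t) ⬝ᵥ Γ⁻¹.mulVec fun k => w k j t) / 2
      + (δ t - M) * (δ t - M) / (2 * g) ≤ v :=
    (le_lyap (M := M) (s := s) (w := w) (δ := δ) hΓ hϱ t j).trans (hVle t ht₀)
  have p1 : 0 ≤ s j t * s j t / (2 * ϱ) := div_nonneg (mul_self_nonneg _) (by positivity)
  have p2 : 0 ≤ (fun k => w k j t) ⬝ᵥ Γ⁻¹.mulVec fun k => w k j t := by
    simpa using hΓ.inv.posSemidef.dotProduct_mulVec_nonneg (fun k => w k j t)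
  have p3 : 0 ≤ (δ t - M) * (δ t - M) / (2 * g) :=
    div_nonneg (mul_self_nonneg _) (by positivity)
  have hσ : |s j t| ≤ σ := by
    refine Real.abs_le_sqrt ?_
    have : s j t * s j t / (2 * ϱ) ≤ v := by linarith
    rw [div_le_iff₀ (by positivity)] at this
    nlinarith
  have hδM : |δ t| ≤ δM := by
    have h1 : |δ t - M| ≤ √(2 * g * v) := by
      refine Real.abs_le_sqrt ?_
      have : (δ t - M) * (δ t - M) / (2 * g) ≤ v := by linarith
      rw [div_le_iff₀ (by positivity)] at this
      nlinarith
    have h2 : |δ t| ≤ |δ t - M| + |M| := by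
      simpa using abs_add_le (δ t - M) M
    linarith
  have hwM : |(fun k => w k j t) ⬝ᵥ φ| ≤ wM := by
    have h1 := abs_dotProduct_le_of_posDef hΓ (fun k => w k j t) φ
    have h2 := dotProduct_mulVec_le_sum_abs Γ hφ
    have h3 : ((fun k => w k j t) ⬝ᵥ Γ⁻¹.mulVec fun k => w k j t) / 2 ≤ v := by linarith
    simp only [wM]
    linarith
  rw [abs_mul, abs_of_pos hϱ]
  gcongr
  have q1 : |k₁ * spow (s j t) γ₁| ≤ b₁ * σ ^ γ₁ := by
    have hk0 : 0 ≤ k₁ := ha₁.le.trans hk₁.1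
    rw [abs_mul, abs_of_nonneg hk0]
    have hpow : |spow (s j t) γ₁| ≤ σ ^ γ₁ := (abs_spow_le _ _).trans (by gcongr)
    exact mul_le_mul hk₁.2 hpow (abs_nonneg _) (hk0.trans hk₁.2)
  have q2 : |k₂ * spow (s j t) γ₂| ≤ b₂ * σ ^ γ₂ := by
    rw [abs_mul, abs_of_nonneg hk₂.1]
    have hpow : |spow (s j t) γ₂| ≤ σ ^ γ₂ := (abs_spow_le _ _).trans (by gcongr)
    exact mul_le_mul hk₂.2 hpow (abs_nonneg _) (hk₂.1.trans hk₂.2)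
  have q3 : |δ t * ξ j| ≤ δM := by
    rw [abs_mul]
    exact (mul_le_of_le_one_right (abs_nonneg _) (hξ j).2.2).trans hδM
  have q4 := hΔ j
  rw [abs_le] at *
  constructor <;> linarith

end Lyapunov

/-! ### Regularity of the terminal sliding mode -/

theorem spow_of_pos {x : ℝ} (hx : 0 < x) (p : ℝ) : spow x p = x ^ p := by
  rw [spow, Real.sign_of_pos hx, abs_of_pos hx, mul_one]

theorem spow_neg (x p : ℝ) : spow (-x) p = -spow x p := by
  rw [spow, spow, Real.sign_neg, abs_neg, mul_neg]

theorem spow_two (x : ℝ) : spow x 2 = x * |x| := by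
  rcases lt_trichotomy x 0 with hx | hx | hx
  · rw [spow, Real.sign_of_neg hx, abs_of_neg hx, Real.rpow_two]; ring
  · simp [hx, spow]
  · rw [spow, Real.sign_of_pos hx, abs_of_pos hx, Real.rpow_two]; ring

namespace SlidingParams

variable (P : SlidingParams)

theorem terminal_neg (x : ℝ) : P.terminal (-x) = -P.terminal x := by
  simp only [terminal, spow_neg]
  rw [← spow_neg _ P.r₀]
  congr 1
  ring

theorem terminal_of_pos {x : ℝ} (hx : 0 < x) :
    P.terminal x = (P.β₁ * x ^ P.r₁ + P.β₂ * x ^ P.r₂) ^ P.r₀ := by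
  have h1 := P.β₁_pos
  have h2 := P.β₂_pos
  rw [terminal, spow_of_pos hx, spow_of_pos hx, spow_of_pos (by positivity)]

theorem poly_neg (x : ℝ) : P.poly (-x) = -P.poly x := by
  simp only [poly, spow_neg]
  ring

/-- The polynomial and the terminal branch agree at `φs`. -/
theorem poly_φs : P.poly P.φs = P.terminal P.φs := by
  have hφ := P.φs_pos
  have h1 := P.β₁_pos
  have h2 := P.β₂_pos
  have hr : P.r₀ ≠ 0 := by linarith [P.r₀_gt]
  -- Write `φs ^ c` as `(φs ^ (c / r₀)) ^ r₀` and move it inside the outer power: the exponents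
  -- become `r₁` and `r₂`. The cases `c = 1, 2` treat `℘₁` and `℘₂`, and the weights `2 - r₀` and
  -- `r₀ - 1` add up to `1`.
  have key : ∀ c : ℝ, spow (P.β₁ * spow P.φs ((P.r₁ * P.r₀ - c) / P.r₀)
      + P.β₂ * spow P.φs ((P.r₂ * P.r₀ - c) / P.r₀)) P.r₀ * P.φs ^ c = P.terminal P.φs := by
    intro c
    rw [P.terminal_of_pos hφ, spow_of_pos hφ, spow_of_pos hφ, spow_of_pos (by positivity)]
    have hc : P.φs ^ c = (P.φs ^ (c / P.r₀)) ^ P.r₀ := by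
      rw [← Real.rpow_mul hφ.le, div_mul_cancel₀ _ hr]
    rw [hc, ← Real.mul_rpow (by positivity) (by positivity), add_mul, mul_assoc, mul_assoc,
      ← Real.rpow_add hφ, ← Real.rpow_add hφ]
    congr 4 <;> field_simp <;> ring
  have k1 := key 1
  have k2 := key 2
  rw [Real.rpow_one] at k1
  rw [Real.rpow_two] at k2
  rw [poly, wp₁, wp₂, spow_of_pos hφ 2, Real.rpow_two]
  linear_combination (2 - P.r₀) * k1 + (P.r₀ - 1) * k2

/-- Truncation replaces the case distinction: outside `[-φs, φs]` the saturated polynomial cancels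
the constant left by a truncated terminal term. The terminal function, which is not Lipschitz at `0`
because `r₂ r₀ < 1`, is evaluated only on `[φs, ∞)`. -/
theorem alphaReg_eq (x : ℝ) : P.alphaReg x = P.poly (max (-P.φs) (min x P.φs))
    + P.terminal (max x P.φs) - P.terminal (max (-x) P.φs) := by
  have hφ := P.φs_pos
  rw [alphaReg]
  split_ifs with h
  · rw [abs_le] at h
    rw [min_eq_left h.2, max_eq_right h.1, max_eq_right h.2, max_eq_right (by linarith)]
    ring
  · rcases lt_or_ge P.φs x with h1 | h1
    · rw [min_eq_right h1.le, max_eq_right (by linarith), max_eq_left h1.le,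
        max_eq_right (by linarith), poly_φs]
      ring
    · have h2 : x < -P.φs := by
        by_contra! h2
        exact h (abs_le.2 ⟨h2, h1⟩)
      rw [min_eq_left h1, max_eq_left h2.le, max_eq_right h1, max_eq_left (by linarith), poly_neg,
        poly_φs, terminal_neg]
      ring

theorem locallyLipschitz_terminal_max : LocallyLipschitz fun x => P.terminal (max x P.φs) := by
  intro x
  have hx : 0 < max x P.φs := lt_max_of_lt_right P.φs_pos
  have h1 := P.β₁_pos
  have h2 := P.β₂_pos
  have hcd : ContDiffAt ℝ 1 (fun y : ℝ => (P.β₁ * y ^ P.r₁ + P.β₂ * y ^ P.r₂) ^ P.r₀)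
      (max x P.φs) := by
    refine ContDiffAt.rpow_const_of_ne ?_ (by positivity)
    exact (contDiffAt_const.mul (Real.contDiffAt_rpow_const_of_ne hx.ne')).add
      (contDiffAt_const.mul (Real.contDiffAt_rpow_const_of_ne hx.ne'))
  obtain ⟨K, u, hu, hK⟩ := hcd.exists_lipschitzOnWith
  refine ⟨K, _, (continuous_id.max continuous_const).continuousAt.preimage_mem_nhds hu, ?_⟩
  have hm : LipschitzWith 1 fun x : ℝ => max x P.φs := LipschitzWith.id.max_const _
  have := hK.comp (hm.lipschitzOnWith (s := (fun x : ℝ => max x P.φs) ⁻¹' u))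
    (fun y hy => hy)
  rw [mul_one] at this
  intro a ha b hb
  have hab := this ha hb
  simp only [Function.comp_apply] at hab
  beta_reduce
  rw [P.terminal_of_pos (lt_max_of_lt_right P.φs_pos),
    P.terminal_of_pos (lt_max_of_lt_right P.φs_pos)]
  exact hab

/-- `α` preserves absolute continuity. -/
theorem absolutelyContinuousOnInterval_alphaReg {f : ℝ → ℝ} {a b : ℝ}
    (hf : AbsolutelyContinuousOnInterval f a b) :
    AbsolutelyContinuousOnInterval (fun t => P.alphaReg (f t)) a b := by
  have hlip : ∀ {g : ℝ → ℝ} {f : ℝ → ℝ}, LocallyLipschitz g →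
      AbsolutelyContinuousOnInterval f a b →
      AbsolutelyContinuousOnInterval (fun t => g (f t)) a b := by
    intro g f hg hf
    -- The range of `f` over the interval is compact, so a single Lipschitz constant serves there.
    obtain ⟨K, hK⟩ := (hg.locallyLipschitzOn (s := f '' uIcc a b)).exists_lipschitzOnWith_of_compact
      (isCompact_uIcc.image_of_continuousOn hf.continuousOn)
    exact absolutelyContinuousOnInterval_of_dist_le K.2 hf fun x hx y hy =>
      hK.dist_le_mul _ (mem_image_of_mem f hx) _ (mem_image_of_mem f hy)
  have hc : AbsolutelyContinuousOnInterval (fun t => max (-P.φs) (min (f t) P.φs)) a b :=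
    hlip (g := fun x => max (-P.φs) (min x P.φs)) ((LipschitzWith.id.min_const P.φs).const_max (-P.φs)).locallyLipschitz hf
  have habs : LocallyLipschitz fun x : ℝ => |x| := lipschitzWith_one_norm.locallyLipschitz
  have hterm : ∀ {f : ℝ → ℝ}, AbsolutelyContinuousOnInterval f a b →
      AbsolutelyContinuousOnInterval (fun t => P.terminal (max (f t) P.φs)) a b := fun hf =>
    hlip (g := fun x => P.terminal (max x P.φs)) P.locallyLipschitz_terminal_max hf
  simp only [alphaReg_eq, poly, spow_two]
  exact (((hc.const_mul _).add ((hc.mul (hlip habs hc)).const_mul _)).add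
    (hterm hf)).sub (hterm hf.neg)

end SlidingParams

/-! ### The sliding modes along a run -/

theorem ACFrom.ae_differentiableAt {f : ℝ → ℝ} {t₀ : ℝ} (hf : ACFrom t₀ f) :
    ∀ᵐ t : ℝ, t₀ ≤ t → DifferentiableAt ℝ f t := by
  have h : ∀ᵐ t : ℝ, ∀ k : ℕ, t ∈ uIcc t₀ (t₀ + k) → DifferentiableAt ℝ f t :=
    ae_all_iff.2 fun k => (hf (t₀ + k) (by simp)).ae_differentiableAt
  filter_upwards [h] with t ht ht₀
  obtain ⟨k, hk⟩ := exists_nat_ge (t - t₀)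
  refine ht k ?_
  rw [uIcc_of_le (by simp)]
  exact ⟨ht₀, by linarith⟩

theorem ACFrom.coord {g : ℝ → E3} {t₀ : ℝ} (hg : ACFrom t₀ g) (j : Fin 3) :
    ACFrom t₀ fun t => g t j := fun b hb =>
  absolutelyContinuousOnInterval_of_dist_le zero_le_one (hg b hb) fun x _ y _ => by
    rw [one_mul, dist_eq_norm, dist_eq_norm]
    exact PiLp.norm_apply_le (g x - g y) j

/-- The sliding mode may jump where the desired velocity switches; with finitely many switching
times the Lyapunov argument can start after the last one. -/
theorem PiecewiseLocAC.exists_acFrom {X : Type*} [PseudoMetricSpace X] {g : ℝ → X}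
    (hg : PiecewiseLocAC g) : ∃ t₁ : ℝ, 0 ≤ t₁ ∧ ACFrom t₁ g := by
  obtain ⟨J, hJ⟩ := hg
  obtain ⟨B, hB⟩ := J.finite_toSet.bddAbove
  refine ⟨max B 0 + 1, by positivity, fun b hb => hJ _ _ (by positivity) hb fun s hs hmem => ?_⟩
  have h1 : s ≤ B := hB hs
  have h2 := hmem.1
  have h3 := le_max_left B 0
  linarith

theorem AETime.ae {p : ℝ → Prop} (h : AETime p) : ∀ᵐ t : ℝ, 0 ≤ t → p t :=
  (ae_restrict_iff' measurableSet_Ici).1 h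

theorem AEEventually.exists_ae {p : ℝ → Prop} (h : AEEventually p) :
    ∃ t₀ : ℝ, ∀ᵐ t : ℝ, t₀ ≤ t → p t := by
  obtain ⟨t₀, ht⟩ := h
  exact ⟨t₀, (ae_restrict_iff' measurableSet_Ici).1 ht⟩

/-- The lower bound on the gains yields uniform dissipation, the upper bound a bounded derivative.
-/
theorem sigmoid_mem_Icc {a b c : ℝ} (hab : a < b) : a + (b - a) / (Real.exp c + 1) ∈ Icc a b := by
  have h := Real.exp_pos c
  have h1 : 0 ≤ (b - a) / (Real.exp c + 1) := div_nonneg (by linarith) (by positivity)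
  have h2 : (b - a) / (Real.exp c + 1) ≤ b - a := div_le_self (by linarith) (by linarith)
  constructor <;> linarith

variable {n m : ℕ} {h : Fin n → ℕ} {D : Design n h} {A : Agents n} {E : Environment m}
  {X : Signals n m h}

theorem abs_rbf_le_one (i : Fin n) (z : Z15) (k : Fin (h i)) : |rbf D i z k| ≤ 1 := by
  rw [rbf, abs_of_pos (Real.exp_pos _), Real.exp_le_one_iff, neg_div]
  exact neg_nonpos.2 (by positivity)

theorem continuous_lumped (i : Fin n) : Continuous (lumped D A i) := by
  have hf := (A.f_lip i).continuous
  unfold lumped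
  fun_prop

theorem lumped_netInput_apply (i : Fin n) (t : ℝ) (j : Fin 3) :
    lumped D A i (netInput D X i t) j = A.f i (X.x₁ i t, X.x₂ i t) j
      + (-(deriv (X.vd i) t j) + D.c₁ * velErr X i t j
        + D.c₂ * deriv (fun s => D.alphaReg (posErr X i s j)) t) := rfl

/-- The terminal sliding mode is dominated by its value in Filippov's sense. -/
theorem SlidingParams.abs_slide_le (P : SlidingParams) (e₁ e₂ : E3) (j : Fin 3) :
    |P.slide e₁ e₂ j| ≤ |P.slideReg e₁ e₂ j| := by
  simp only [slide, slideReg, alphaReg]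
  -- The two values can differ only for `σ₁ = 0` and `|e₁ j| ≤ φs`, and there `slide` is `ϱ * σ₁ =
  -- 0`.
  by_cases hle : |e₁ j| ≤ P.φs
  · by_cases hσ : P.σ₁ (e₁ j) (e₂ j) = 0
    · rw [if_neg (by simp [hσ]), hσ, mul_zero, abs_zero]
      exact abs_nonneg _
    · simp [hσ, hle, σ₂]
  · simp [hle, σ₁]

theorem IsClosedLoop.posErr_acFrom (hX : IsClosedLoop D A E X) (i : Fin n) (j : Fin 3) :
    ACFrom 0 fun t => posErr X i t j := fun b hb =>
  (ACFrom.coord (hX.x₁_ac i) j b hb).sub (ACFrom.coord (hX.xd_ac i) j b hb)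

theorem IsClosedLoop.alphaReg_acFrom (hX : IsClosedLoop D A E X) (i : Fin n) (j : Fin 3) :
    ACFrom 0 fun t => D.alphaReg (posErr X i t j) := fun b hb =>
  D.absolutelyContinuousOnInterval_alphaReg (hX.posErr_acFrom i j b hb)

theorem IsClosedLoop.SF_acFrom (hX : IsClosedLoop D A E X) {i : Fin n} {t₁ : ℝ} (h₁ : 0 ≤ t₁)
    (hvd : ACFrom t₁ (X.vd i)) (j : Fin 3) : ACFrom t₁ fun t => SF D X i t j := fun b hb =>
  (((((ACFrom.coord (hX.x₂_ac i) j).on h₁ hb).sub (hvd.coord j b hb)).add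
    (((hX.posErr_acFrom i j).on h₁ hb).const_mul _)).add
    (((hX.alphaReg_acFrom i j).on h₁ hb).const_mul _)).const_mul _

/-- The dynamics of the sliding mode after the last switching time. -/
theorem IsClosedLoop.SF_ode (hX : IsClosedLoop D A E X) {i : Fin n} {t₁ : ℝ} (h₁ : 0 ≤ t₁)
    (hvd : ACFrom t₁ (X.vd i)) :
    ∀ᵐ t : ℝ, t₁ ≤ t → ∃ ξ : Fin 3 → ℝ, (∀ j, ξ j ∈ SGN (SF D X i t j)) ∧
      ∀ j, HasDerivAt (fun s => SF D X i s j)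
        (D.ϱ * (-(k₁ D i t) * spow (SF D X i t j) D.γ₁ - k₂ D i t * spow (SF D X i t j) D.γ₂
          - (fun k => X.What i t k j) ⬝ᵥ rbf D i (netInput D X i t) - X.δhat i t * ξ j
          + (lumped D A i (netInput D X i t) j + A.dist i (X.x₁ i t, X.x₂ i t) t j))) t := by
  -- The network input contains values of `deriv`; differentiability almost everywhere makes them
  -- true derivatives.
  have hα : ∀ᵐ t : ℝ, ∀ j, 0 ≤ t →
      DifferentiableAt ℝ (fun s => D.alphaReg (posErr X i s j)) t :=
    ae_all_iff.2 fun j => (hX.alphaReg_acFrom i j).ae_differentiableAt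
  have hv : ∀ᵐ t : ℝ, ∀ j, t₁ ≤ t → DifferentiableAt ℝ (fun s => X.vd i s j) t :=
    ae_all_iff.2 fun j => (hvd.coord j).ae_differentiableAt
  filter_upwards [hα, hv, (hX.x₁_ode i).ae, (hX.xd_ode i).ae, (hX.x₂_ode i).ae]
    with t hα hv hx₁ hxd hx₂ ht
  have ht0 := h₁.trans ht
  obtain ⟨ξ, hξ, hx₂⟩ := hx₂ ht0
  refine ⟨ξ, hξ, fun j => ?_⟩
  have hv' : HasDerivAt (X.vd i) (deriv (X.vd i) t) t :=
    (differentiableAt_euclidean.2 fun j => hv j ht).hasDerivAt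
  have hcoord : ∀ {g : ℝ → E3} {g' : E3}, HasDerivAt g g' t →
      HasDerivAt (fun s => g s j) (g' j) t := fun hg =>
    (EuclideanSpace.proj (𝕜 := ℝ) j).hasFDerivAt.comp_hasDerivAt t hg
  have hpos := (hcoord ((hx₁ ht0).sub (hxd ht0))).const_mul D.c₁
  have hvel := hcoord (hx₂.sub hv')
  have hα' := ((hα j ht0).hasDerivAt).const_mul D.c₂
  refine (((hvel.add hpos).add hα').const_mul D.ϱ).congr_deriv ?_
  rw [lumped_netInput_apply]
  simp only [PiLp.add_apply, PiLp.sub_apply, control, velErr, Matrix.mulVec, Matrix.transpose_apply,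
    dotProduct]
  ring

theorem IsClosedLoop.tendsto_SF (hX : IsClosedLoop D A E X) {i : Fin n} {Ω : Set Z15}
    (hΩ : IsCompact Ω) {W : ℝ → Matrix (Fin (h i)) (Fin 3) ℝ} {εN δ : ℝ}
    (hW : ∀ t : ℝ, 0 ≤ t → ∀ z ∈ Ω, ‖approxErr D A i (W t) z‖ ≤ εN)
    (hz : AEEventually fun t => netInput D X i t ∈ Ω)
    (hδ : AEEventually fun t => ‖approxErr D A i (W t) (netInput D X i t)
      + A.dist i (X.x₁ i t, X.x₂ i t) t‖ ≤ δ) (j : Fin 3) :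
    Tendsto (fun t => SF D X i t j) atTop (𝓝 0) := by
  obtain ⟨t₁, h₁, hvd⟩ := (hX.vd_ac i).exists_acFrom
  obtain ⟨t₂, hz⟩ := hz.exists_ae
  obtain ⟨t₃, hδ⟩ := hδ.exists_ae
  obtain ⟨M, hM⟩ := hΩ.exists_bound_of_continuousOn
    (continuous_lumped (D := D) (A := A) i).continuousOn
  set t₀ := max t₁ (max t₂ t₃)
  have h10 : t₁ ≤ t₀ := le_max_left _ _
  have h20 : t₂ ≤ t₀ := (le_max_left _ _).trans (le_max_right _ _)
  have h30 : t₃ ≤ t₀ := (le_max_right _ _).trans (le_max_right _ _)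
  have h0 : 0 ≤ t₀ := h₁.trans h10
  -- The uncertainty is split as `F + d = F + (ε + d) - ε`, which gives the bound `M + δ + εN`.
  refine tendsto_zero_of_adaptive_reaching (s := fun j t => SF D X i t j)
    (w := fun k j t => X.What i t k j) (δ := X.δhat i) (M := M + δ + εN) (t₀ := t₀)
    (γ₁ := D.γ₁) (γ₂ := D.γ₂) (b₁ := D.k₁M i) (b₂ := D.k₂M i)
    (D.Γ_pos i) D.ϱ_pos (D.γ₃_pos i) (by linarith [D.γ₁_gt]) D.γ₂_pos (D.k₁0_pos i)
    (fun j => (hX.SF_acFrom h₁ hvd j).mono h10) (fun k j => ACFrom.mono (hX.What_ac i k j) h0)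
    (ACFrom.mono (hX.δhat_ac i) h0) ?_ j
  filter_upwards [hz, hδ, hX.SF_ode h₁ hvd, (hX.What_ode i).ae, (hX.δhat_ode i).ae]
    with t hz hδ hs hWhat hδhat ht
  have ht0 := h0.trans ht
  obtain ⟨ξ, hξ, hs⟩ := hs (h10.trans ht)
  have hz := hz (h20.trans ht)
  refine ⟨rbf D i (netInput D X i t), ξ, fun j => _, k₁ D i t, k₂ D i t,
    abs_rbf_le_one i _, hξ, fun j => ?_, sigmoid_mem_Icc (D.k₁M_gt i), ?_, hs, hWhat ht0,
    hδhat ht0⟩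
  · set z := netInput D X i t
    set e := approxErr D A i (W t) z
    set d := A.dist i (X.x₁ i t, X.x₂ i t) t
    have hle : ‖lumped D A i z + (e + d) - e‖ ≤ M + δ + εN := (norm_sub_le _ _).trans
      (add_le_add ((norm_add_le _ _).trans (add_le_add (hM z hz) (hδ (h30.trans ht))))
        (hW t ht0 z hz))
    have heq : lumped D A i z + (e + d) - e = lumped D A i z + d := by abel
    rw [heq] at hle
    exact (PiLp.norm_apply_le (lumped D A i z + d) j).trans hle
  · have := sigmoid_mem_Icc (c := -D.cs₂ * (t - D.T₀)) (D.k₂M_gt i)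
    exact ⟨(D.k₂0_pos i).le.trans this.1, this.2⟩

end MultiAgent

end

/-! ### Ultimate boundedness of the sliding modes of all agents -/

theorem theorem2 {n m : ℕ} (hn : 2 ≤ n) {h : Fin n → ℕ} (D : MultiAgent.Design n h)
    (A : MultiAgent.Agents n) (E : MultiAgent.Environment m)
    -- the networks approximate the lumped uncertainties on compact sets
    (Ω : Fin n → Set MultiAgent.Z15) (hΩ : ∀ i, IsCompact (Ω i))
    (W : ∀ i, ℝ → Matrix (Fin (h i)) (Fin 3) ℝ) (εN : Fin n → ℝ) (hεN : ∀ i, 0 < εN i)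
    (hW : ∀ i, ∀ t : ℝ, 0 ≤ t → ∀ z ∈ Ω i, ‖MultiAgent.approxErr D A i (W i t) z‖ ≤ εN i)
    -- a run of the closed loop
    (X : MultiAgent.Signals n m h) (hX : MultiAgent.IsClosedLoop D A E X)
    -- the network inputs stay in the sets of approximation, at least from some time on
    (hz : ∀ i, MultiAgent.AEEventually fun t => MultiAgent.netInput D X i t ∈ Ω i)
    -- the total disturbances are bounded from some time on, by constants unknown to the controller
    (δ : Fin n → ℝ)
    (hδ : ∀ i, MultiAgent.AEEventually fun t =>
      ‖MultiAgent.approxErr D A i (W i t) (MultiAgent.netInput D X i t)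
        + A.dist i (X.x₁ i t, X.x₂ i t) t‖ ≤ δ i)
    -- the bound on the velocity of the leader
    (hK₃ : ∀ t : ℝ, 0 ≤ t → ∀ j, |deriv E.leader t j| ≤ D.K₃)
    -- the lower bound on the gains of the collision avoidance behavior
    (G : MultiAgent.GainConsts n) (hG : MultiAgent.GainConsts.Admissible D E X G)
    (hlam : ∀ i, ∀ t : ℝ, 0 ≤ t →
      max (max (MultiAgent.lam₁ D E X G i) (MultiAgent.lam₂ D E X G i))
        (MultiAgent.lamStar D E X i t) < X.lam i t)
    (δs : ℝ) (hδs : 0 < δs) :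
    ∃ T : ℝ, 0 < T ∧ ∀ i, ∀ t : ℝ, T ≤ t → ‖MultiAgent.S D X i t‖ ≤ δs := by
  have hS : ∀ i, ∀ᶠ t in Filter.atTop, ‖MultiAgent.S D X i t‖ ≤ δs := fun i => by
    -- Three coordinates below `δs / 2` give a squared norm of at most `3 δs² / 4`.
    have hev : ∀ᶠ t in Filter.atTop, ∀ j, |MultiAgent.SF D X i t j| < δs / 2 :=
      Filter.eventually_all.2 fun j => by
        have := (hX.tendsto_SF (hΩ i) (hW i) (hz i) (hδ i) j).abs
        rw [abs_zero] at this
        exact this.eventually_lt_const (by positivity)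
    filter_upwards [hev] with t ht
    have hj : ∀ j, MultiAgent.S D X i t j ^ 2 ≤ (δs / 2) ^ 2 := fun j =>
      sq_le_sq' (abs_le.1 ((D.abs_slide_le _ _ j).trans (ht j).le)).1
        (abs_le.1 ((D.abs_slide_le _ _ j).trans (ht j).le)).2
    rw [EuclideanSpace.norm_eq]
    refine Real.sqrt_le_iff.2 ⟨hδs.le, ?_⟩
    simp only [Real.norm_eq_abs, sq_abs, Fin.sum_univ_three]
    nlinarith [hj 0, hj 1, hj 2]
  obtain ⟨T, hT⟩ := Filter.eventually_atTop.1 (Filter.eventually_all.2 hS)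
  exact ⟨max T 1, by positivity, fun i t ht => hT t ((le_max_left _ _).trans ht) i⟩
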